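/- For a finite simple graph $G$ write $d_G(u)$ for the degree of a vertex $u$, and let $SO(G)=\sum_{uv\in E(G)}\sqrt{d_G(u)^2+d_G(v)^2}$ be its Sombor index. For integers $n,k$ let $\mathscr Q(n,k)$ be the class of connected simple graphs $G$ of order $n$ that have a vertex $u$ with $d_G(u)=k$ such that $G-u$ is a tree. Let $S_m=K_{1,m-1}$ be the star of order $m$, and define the following graphs of order $n$: - $Q_{n,k}$ ($1\le k\le n-1$) is obtained from the star $S_{n-1}$ and an isolated vertex $v$ by joining $v$ to the centre of $S_{n-1}$ and to $k-1$ of its leaves; - $Q^*_{n,k}$ ($1\le k\le n-2$) is obtained from $S_{n-1}$ and an isolated vertex $v$ by joining $v$ to $k$ leaves of $S_{n-1}$ (and not to the centre); - $Q'_{n,k}$ ($3\le k\le n-1$) is obtained from $Q_{n-1,k-1}$, with its vertex $v$ of degree $k-1$ as above, by adding a new vertex joined exactly to $v$ and to one of the leaves of the star $S_{n-2}$ that are adjacent to $v$ (a vertex of degree $2$ in $Q_{n-1,k-1}$). For $3\le k\le n-1$ put $$\phi'(n,k)=(k-2)\sqrt{k^2+4}+(k-3)\sqrt{(n-2)^2+4}+(n-k-1)\sqrt{(n-2)^2+1}+\sqrt{k^2+(n-2)^2}+\sqrt{(n-2)^2+9}+\sqrt{k^2+9}+\sqrt{13}.$$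 **Theorem.** Let $n\ge 23$ and $4\le k\le n-2$, and let $G\in\mathscr Q(n,k)$ with $G\not\cong Q_{n,k}$ and $G\not\cong Q^*_{n,k}$. Then $$SO(G)\le \phi'(n,k),$$ with equality if and only if $G\cong Q'_{n,k}$. -/

import Mathlib

/-- The Sombor index `SO(G)`: the sum over all edges `uv` of `√(d(u)² + d(v)²)`. -/
noncomputable def sombor {V : Type*} [Fintype V] [DecidableEq V]
    (G : SimpleGraph V) [DecidableRel G.Adj] : ℝ :=
  ∑ e ∈ G.edgeFinset,
    Sym2.lift ⟨fun u v : V => Real.sqrt ((G.degree u : ℝ) ^ 2 + (G.degree v : ℝ) ^ 2),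
      fun _ _ => congrArg Real.sqrt (add_comm _ _)⟩ e

/-- `G` belongs to the class `Q(n, k)`: it is a connected graph of order `n` with a vertex `u` of
degree `k` such that `G - u` is a tree. -/
def IsQuasiTreeOf {V : Type*} [Fintype V] (G : SimpleGraph V) [DecidableRel G.Adj]
    (n k : ℕ) : Prop :=
  Fintype.card V = n ∧ G.Connected ∧
    ∃ u : V, (G.induce ({u}ᶜ : Set V)).IsTree ∧ G.degree u = k

/-- The graph `Q_{n,k}` (`1 ≤ k ≤ n - 1`). The vertices other than `1` carry the star `S_{n-1}`
with centre `0`; the extra vertex `v = 1` is joined to the centre `0` and to the `k - 1` leaves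
`2, …, k`. -/
def graphQ (n k : ℕ) : SimpleGraph (Fin n) :=
  SimpleGraph.fromRel fun i j =>
    (i.val = 0 ∧ 1 ≤ j.val) ∨ (i.val = 1 ∧ 2 ≤ j.val ∧ j.val ≤ k)

/-- The graph `Q*_{n,k}` (`1 ≤ k ≤ n - 2`). The vertices other than `1` carry the star `S_{n-1}`
with centre `0`; the extra vertex `v = 1` is joined to the `k` leaves `2, …, k + 1` only. -/
def graphQStar (n k : ℕ) : SimpleGraph (Fin n) :=
  SimpleGraph.fromRel fun i j =>
    (i.val = 0 ∧ 2 ≤ j.val) ∨ (i.val = 1 ∧ 2 ≤ j.val ∧ j.val ≤ k + 1)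

/-- The graph `Q'_{n,k}` (`3 ≤ k ≤ n - 1`). The vertices `0, …, n - 2` carry `Q_{n-1,k-1}`, labelled
as in `graphQ`, and the new vertex `n - 1` is joined to the vertex `1`, which has degree `k - 1`
in `Q_{n-1,k-1}`, and to the vertex `2`, which has degree `2` there. -/
def graphQPrime (n k : ℕ) : SimpleGraph (Fin n) :=
  SimpleGraph.fromRel fun i j =>
    (j.val + 1 < n ∧
      ((i.val = 0 ∧ 1 ≤ j.val) ∨ (i.val = 1 ∧ 2 ≤ j.val ∧ j.val ≤ k - 1))) ∨
    (j.val + 1 = n ∧ (i.val = 1 ∨ i.val = 2))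

/-- The number `φ'(n,k)`, given by this formula for `3 ≤ k ≤ n - 1`. -/
noncomputable def phiPrime (n k : ℕ) : ℝ :=
  ((k : ℝ) - 2) * Real.sqrt ((k : ℝ) ^ 2 + 4)
    + ((k : ℝ) - 3) * Real.sqrt (((n : ℝ) - 2) ^ 2 + 4)
    + ((n : ℝ) - k - 1) * Real.sqrt (((n : ℝ) - 2) ^ 2 + 1)
    + Real.sqrt ((k : ℝ) ^ 2 + ((n : ℝ) - 2) ^ 2)
    + Real.sqrt (((n : ℝ) - 2) ^ 2 + 9)
    + Real.sqrt ((k : ℝ) ^ 2 + 9)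
    + Real.sqrt 13

/-! Let `u` be the apex and `T = G - u`, a tree on `n - 1` vertices. Each `x ≠ u` gets the excess `s
x = d_T(x) - 1 ≥ 0`; by the handshake lemma the excesses add up to `n - 3`. This numerical budget
replaces the tree structure in everything after `IsQuasiTreeOf.exists_excess`.

An excess equal to `n - 3` makes `T` a star, so `G` is `Q` or `Q*`, which are excluded. Hence all
excesses are at most `n - 4`. The index splits into the `k` edges at `u` and the `n - 2` edges of
`T`, and each part is bounded separately.

Edges at `u`: a neighbour has degree `2 + s w`, and `√(k² + (2 + j)²)` is convex in `j`, so the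
worst excesses are `n - 4, 1, 0, …, 0` (`HasExcess.sum_apex_le`).

Edges of `T`: if some excess is `n - 4`, then `T` is a broom (a star with one edge prolonged), the
sum is explicit, and it reaches `restBound` exactly when `u` is joined to the centre, the middle and
the end of the broom (`IsBroomOff.sum_rest_le`). These adjacencies and `d(u) = k` determine `G`,
which is `Q'`. Otherwise all excesses are at most `n - 5` and the sum is at most `(n - 2)(n - 3)`,
which is below `restBound` (`lt_restBound`). -/

/-! ### Convexity and the exchange inequality -/

open Finset in
/-- Convex sums of bounded naturals are largest when all but one unit is concentrated. -/
theorem sum_le_of_discrete_convex {ι : Type*} [DecidableEq ι] (g : ℕ → ℝ)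
    (hconv : ∀ a p q, g (a + p) + g (a + q) ≤ g a + g (a + p + q)) (hmono : Monotone g)
    (A : Finset ι) (s : ι → ℕ) (M : ℕ) (hA : 2 ≤ A.card)
    (hsum : ∑ i ∈ A, s i ≤ M + 1) (hs : ∀ i ∈ A, s i ≤ M) :
    ∑ i ∈ A, g (s i) ≤ g M + g 1 + ((A.card : ℝ) - 2) * g 0 := by
  -- Superadditivity of `g - g 0`: the values over `B` can be merged into a single one.
  have hsuper : ∀ B : Finset ι,
      ∑ i ∈ B, g (s i) + g 0 ≤ g (∑ i ∈ B, s i) + (B.card : ℝ) * g 0 := by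
    intro B
    induction B using Finset.induction_on with
    | empty => simp
    | insert a B ha ih =>
      rw [sum_insert ha, sum_insert ha, card_insert_of_notMem ha]
      have h := hconv 0 (s a) (∑ i ∈ B, s i)
      simp only [zero_add] at h
      push_cast
      linarith
  by_cases h : ∃ c ∈ A, 1 ≤ s c
  · obtain ⟨c, hc, hc1⟩ := h
    have hcM := hs c hc
    have h1 := hsuper (A.erase c)
    have h2 := add_sum_erase A s hc
    have h3 := add_sum_erase A (fun i => g (s i)) hc
    have h4 : ((A.erase c).card : ℝ) = A.card - 1 := by
      rw [card_erase_of_mem hc, Nat.cast_sub (by omega)]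
      simp
    have h5 : g (∑ i ∈ A.erase c, s i) ≤ g (M + 1 - s c) := hmono (by omega)
    -- After merging, two values `s c` and `M + 1 - s c` remain, both at least `1`; spreading them
    -- apart with fixed sum gives `1` and `M`.
    have h6 := hconv 1 (s c - 1) (M - s c)
    rw [show 1 + (s c - 1) + (M - s c) = M by omega, show 1 + (s c - 1) = s c by omega,
      show 1 + (M - s c) = M + 1 - s c by omega] at h6
    rw [h4] at h1
    linarith
  · push Not at h
    have h1 : ∑ i ∈ A, g (s i) = A.card * g 0 := by
      rw [sum_congr rfl (fun i hi => by rw [show s i = 0 by have := h i hi; omega])]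
      simp
    have h2 := hmono (Nat.zero_le M)
    have h3 := hmono (Nat.zero_le 1)
    linarith

/-- The function is the norm of `K + ix`, so convexity is the triangle inequality in `ℂ`. -/
theorem convexOn_sqrt_sq_add_sq (K : ℝ) :
    ConvexOn ℝ Set.univ fun x : ℝ => Real.sqrt (K ^ 2 + x ^ 2) := by
  refine ⟨convex_univ, fun x _ y _ a b ha hb hab => ?_⟩
  have key : ∀ z : ℝ, Real.sqrt (K ^ 2 + z ^ 2) = ‖(⟨K, z⟩ : ℂ)‖ := by
    intro z
    rw [Complex.norm_def, Complex.normSq_mk]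
    ring_nf
  simp only [key, smul_eq_mul]
  have : (⟨K, a * x + b * y⟩ : ℂ) = (a : ℂ) * ⟨K, x⟩ + (b : ℂ) * ⟨K, y⟩ := by
    apply Complex.ext
    · simp [← add_mul, hab]
    · simp
  rw [this]
  refine (norm_add_le _ _).trans (le_of_eq ?_)
  simp [abs_of_nonneg ha, abs_of_nonneg hb]

/-- Both `a + p` and `a + q` are convex combinations of `a` and `a + p + q`, with the two weights
interchanged; adding the two convexity inequalities gives the claim. -/
theorem sqrt_sq_add_sq_exchange (K a p q : ℝ) (hp : 0 ≤ p) (hq : 0 ≤ q) :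
    Real.sqrt (K ^ 2 + (a + p) ^ 2) + Real.sqrt (K ^ 2 + (a + q) ^ 2) ≤
      Real.sqrt (K ^ 2 + a ^ 2) + Real.sqrt (K ^ 2 + (a + p + q) ^ 2) := by
  rcases eq_or_lt_of_le (add_nonneg hp hq) with h | h
  · have h1 : p = 0 := by linarith
    have h2 : q = 0 := by linarith
    simp [h1, h2]
  have hc := (convexOn_sqrt_sq_add_sq K).2
  have h1 := hc (Set.mem_univ a) (Set.mem_univ (a + p + q)) (a := q / (p + q)) (b := p / (p + q))
    (by positivity) (by positivity) (by field_simp; ring)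
  have h2 := hc (Set.mem_univ a) (Set.mem_univ (a + p + q)) (a := p / (p + q)) (b := q / (p + q))
    (by positivity) (by positivity) (by field_simp)
  simp only [smul_eq_mul] at h1 h2
  rw [show q / (p + q) * a + p / (p + q) * (a + p + q) = a + p by field_simp; ring] at h1
  rw [show p / (p + q) * a + q / (p + q) * (a + p + q) = a + q by field_simp; ring] at h2
  have h3 : q / (p + q) = 1 - p / (p + q) := by field_simp; ring
  rw [h3] at h1 h2
  linarith

/-! ### Isomorphisms from vertex colourings -/

/-- Colourings of two graphs with the same colour adjacency and the same colour class sizes give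
an isomorphism. -/
theorem nonempty_iso_of_coloring {V W ι : Type*} [Fintype V] [Fintype W] [DecidableEq ι]
    (G : SimpleGraph V) (H : SimpleGraph W) (R : ι → ι → Prop) (f : V → ι) (g : W → ι)
    (hG : ∀ x y, G.Adj x y ↔ R (f x) (f y)) (hH : ∀ x y, H.Adj x y ↔ R (g x) (g y))
    (hc : ∀ i, (Finset.univ.filter fun x => f x = i).card =
      (Finset.univ.filter fun x => g x = i).card) :
    Nonempty (G ≃g H) := by
  have h : ∀ i, Nonempty ({x // f x = i} ≃ {x // g x = i}) := by
    intro i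
    rw [← Fintype.card_eq, Fintype.card_subtype, Fintype.card_subtype]
    exact hc i
  let e := fun i => (h i).some
  let E : V ≃ W := (Equiv.sigmaFiberEquiv f).symm.trans
    ((Equiv.sigmaCongrRight e).trans (Equiv.sigmaFiberEquiv g))
  have hE : ∀ x, g (E x) = f x := fun x => (e (f x) ⟨x, rfl⟩).2
  exact ⟨⟨E, by intro x y; rw [hH, hE, hE, hG]⟩⟩

/-! ### Splitting edge sums, and the excess of a vertex -/

section EdgeSums

variable {V : Type*} [Fintype V] [DecidableEq V] (G : SimpleGraph V) [DecidableRel G.Adj]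

theorem SimpleGraph.sum_edgeFinset_eq_add {M : Type*} [AddCommMonoid M] (F : Sym2 V → M) (u : V) :
    ∑ e ∈ G.edgeFinset, F e =
      ∑ w ∈ G.neighborFinset u, F s(u, w) + ∑ e ∈ G.edgeFinset.filter (fun e => u ∉ e), F e := by
  rw [← Finset.sum_filter_add_sum_filter_not G.edgeFinset (fun e => u ∈ e)]
  congr 1
  symm
  refine Finset.sum_bij (fun w _ => s(u, w)) ?_ ?_ ?_ (fun _ _ => rfl)
  · intro w hw
    simpa using hw
  · intro a _ b _ h
    exact Sym2.congr_right.mp h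
  · intro e he
    induction e using Sym2.ind with
    | _ x y =>
      simp only [Finset.mem_filter, SimpleGraph.mem_edgeFinset, SimpleGraph.mem_edgeSet,
        Sym2.mem_iff] at he
      obtain ⟨h, rfl | rfl⟩ := he
      · exact ⟨y, by simpa using h, rfl⟩
      · exact ⟨x, by simpa using h.symm, Sym2.eq_swap⟩

theorem SimpleGraph.sum_edgeFinset_filter_eq_add {M : Type*} [AddCommMonoid M] (F : Sym2 V → M)
    {u c : V} (huc : c ≠ u) :
    ∑ e ∈ G.edgeFinset.filter (fun e => u ∉ e), F e =
      ∑ w ∈ (G.neighborFinset c).erase u, F s(c, w) +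
        ∑ e ∈ G.edgeFinset.filter (fun e => u ∉ e ∧ c ∉ e), F e := by
  rw [← Finset.sum_filter_add_sum_filter_not (G.edgeFinset.filter (fun e => u ∉ e))
    (fun e => c ∈ e), Finset.filter_filter, Finset.filter_filter]
  congr 1
  symm
  refine Finset.sum_bij (fun w _ => s(c, w)) ?_ ?_ ?_ (fun _ _ => rfl)
  · intro w hw
    simp only [Finset.mem_erase, SimpleGraph.mem_neighborFinset] at hw
    simp [hw.2, huc.symm, hw.1.symm]
  · intro a _ b _ h
    exact Sym2.congr_right.mp h
  · intro e he
    induction e using Sym2.ind with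
    | _ x y =>
      simp only [Finset.mem_filter, SimpleGraph.mem_edgeFinset, SimpleGraph.mem_edgeSet,
        Sym2.mem_iff, not_or] at he
      obtain ⟨h, ⟨h1, h2⟩, rfl | rfl⟩ := he
      · exact ⟨y, by simpa using ⟨Ne.symm h2, h⟩, rfl⟩
      · exact ⟨x, by simpa using ⟨Ne.symm h1, h.symm⟩, Sym2.eq_swap⟩

/-- In a quasi-tree, every vertex other than the apex `u` has a positive number of neighbours
other than `u`; the excesses over one add up to `n - 3`. -/
theorem IsQuasiTreeOf.exists_excess {G : SimpleGraph V} [DecidableRel G.Adj] {n k : ℕ}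
    (hG : IsQuasiTreeOf G n k) (hn : 3 ≤ n) :
    ∃ u : V, ∃ s : V → ℕ, G.degree u = k ∧
      (∀ x, x ≠ u → G.degree x = s x + 1 + if G.Adj u x then 1 else 0) ∧
      ∑ x ∈ Finset.univ.erase u, s x + 3 = n ∧
      (G.edgeFinset.filter (fun e => u ∉ e)).card + 2 = n := by
  obtain ⟨hV, -, u, hT, hu⟩ := hG
  have hcard : Fintype.card ({u}ᶜ : Set V) + 1 = n := by
    have h1 := Set.toFinset_card ({u}ᶜ : Set V)
    have h2 : ({u}ᶜ : Set V).toFinset = Finset.univ.erase u := by ext; simp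
    rw [h2, Finset.card_erase_of_mem (Finset.mem_univ u), Finset.card_univ] at h1
    omega
  have hpos : ∀ x, x ≠ u → ∃ y, y ≠ u ∧ G.Adj x y := by
    intro x hx
    have : Nontrivial ({u}ᶜ : Set V) := Fintype.one_lt_card_iff_nontrivial.mp (by omega)
    have h := hT.1.preconnected.degree_pos_of_nontrivial (⟨x, hx⟩ : ({u}ᶜ : Set V))
    rw [SimpleGraph.degree_pos_iff_exists_adj] at h
    obtain ⟨⟨y, hy⟩, h⟩ := h
    exact ⟨y, hy, h⟩
  have hd : ∀ x, x ≠ u → 1 + (if G.Adj u x then 1 else 0) ≤ G.degree x := by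
    intro x hx
    obtain ⟨y, hy, hxy⟩ := hpos x hx
    split_ifs with h
    · rw [← SimpleGraph.card_neighborFinset_eq_degree]
      have : ({y, u} : Finset V) ⊆ G.neighborFinset x := by
        intro z hz
        simp only [Finset.mem_insert, Finset.mem_singleton] at hz
        rcases hz with rfl | rfl
        · simpa using hxy
        · simpa using h.symm
      have h2 := Finset.card_le_card this
      rwa [Finset.card_pair hy] at h2
    · exact (SimpleGraph.degree_pos_iff_exists_adj G x).mpr ⟨y, hxy⟩
  have hE := hT.card_edgeFinset
  rw [SimpleGraph.card_edgeFinset_induce_compl_singleton,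
    SimpleGraph.card_edgeFinset_deleteIncidenceSet] at hE
  have hsplit := G.sum_edgeFinset_eq_add (fun _ => 1) u
  simp only [Finset.sum_const, smul_eq_mul, mul_one,
    SimpleGraph.card_neighborFinset_eq_degree] at hsplit
  -- The natural-number subtractions do not truncate, by `hd`: every vertex of the tree has a
  -- neighbour in it.
  refine ⟨u, fun x => G.degree x - 1 - if G.Adj u x then 1 else 0, hu, ?_, ?_, by omega⟩
  · intro x hx
    have := hd x hx
    simp only
    omega
  · have hsum := G.sum_degrees_eq_twice_card_edges
    rw [← Finset.add_sum_erase _ _ (Finset.mem_univ u)] at hsum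
    have h1 : ∑ x ∈ Finset.univ.erase u, G.degree x =
        ∑ x ∈ Finset.univ.erase u, (G.degree x - 1 - if G.Adj u x then 1 else 0) +
        ∑ x ∈ Finset.univ.erase u, 1 + ∑ x ∈ Finset.univ.erase u, if G.Adj u x then 1 else 0 := by
      rw [← Finset.sum_add_distrib, ← Finset.sum_add_distrib]
      refine Finset.sum_congr rfl fun x hx => ?_
      have := hd x (Finset.ne_of_mem_erase hx)
      omega
    have h2 : ∑ x ∈ Finset.univ.erase u, (if G.Adj u x then 1 else 0) = k := by
      rw [← hu, ← SimpleGraph.card_neighborFinset_eq_degree, Finset.sum_boole]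
      simp only [Nat.cast_id]
      congr 1
      ext x
      simp only [Finset.mem_filter, Finset.mem_erase, Finset.mem_univ, and_true,
        SimpleGraph.mem_neighborFinset, and_iff_right_iff_imp]
      exact fun h => h.ne'
    have h3 : ∑ x ∈ Finset.univ.erase u, 1 = n - 1 := by
      simp [Finset.card_erase_of_mem, hV]
    rw [h1] at hsum
    simp only
    omega

end EdgeSums

/-! ### Stars and brooms forced by a large excess -/

section Shapes

variable {V : Type*} [Fintype V] [DecidableEq V]

/-- The vertices other than `u` carry a star with centre `c`. -/
structure IsStarOff (G : SimpleGraph V) (u c : V) : Prop where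
  huc : u ≠ c
  adj : ∀ x y, x ≠ u → y ≠ u → (G.Adj x y ↔ (x = c ∧ y ≠ c) ∨ (y = c ∧ x ≠ c))

/-- The vertices other than `u` carry a star with centre `c`, one edge `cm` of which is extended
by a pendant edge `mp`. -/
structure IsBroomOff (G : SimpleGraph V) (u c m p : V) : Prop where
  huc : u ≠ c
  hum : u ≠ m
  hup : u ≠ p
  hcm : c ≠ m
  hcp : c ≠ p
  hmp : m ≠ p
  adj : ∀ x y, x ≠ u → y ≠ u → (G.Adj x y ↔ (x = c ∧ y ≠ c ∧ y ≠ p) ∨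
    (y = c ∧ x ≠ c ∧ x ≠ p) ∨ (x = m ∧ y = p) ∨ (x = p ∧ y = m))

theorem IsBroomOff.card_rest {G : SimpleGraph V} {u c m p : V} (h : IsBroomOff G u c m p) :
    (Finset.univ \ {u, c, p, m}).card + 4 = Fintype.card V := by
  obtain ⟨huc, hum, hup, hcm, hcp, hmp, adj⟩ := h
  have h4 : ({u, c, p, m} : Finset V).card = 4 := by
    rw [Finset.card_insert_of_notMem (by simp [*]), Finset.card_insert_of_notMem (by simp [*]),
      Finset.card_pair hmp.symm]
  have := Finset.card_sdiff_add_card_eq_card (Finset.subset_univ ({u, c, p, m} : Finset V))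
  rw [h4, Finset.card_univ] at this
  exact this

variable (G : SimpleGraph V) [DecidableRel G.Adj]

theorem SimpleGraph.degree_eq_card_erase_add (u x : V) :
    G.degree x = ((G.neighborFinset x).erase u).card + if G.Adj u x then 1 else 0 := by
  rw [← SimpleGraph.card_neighborFinset_eq_degree]
  split_ifs with h
  · rw [Finset.card_erase_add_one]
    simpa using h.symm
  · rw [Finset.erase_eq_of_notMem, add_zero]
    simpa using fun h' => h h'.symm

variable {G}

theorem IsBroomOff.erase_center {u c m p : V} (h : IsBroomOff G u c m p) :
    (G.neighborFinset c).erase u = insert m (Finset.univ \ {u, c, p, m}) := by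
  ext y
  obtain ⟨huc, hum, hup, hcm, hcp, hmp, adj⟩ := h
  by_cases hy : y = u
  · subst hy; simp [hum]
  · have := adj c y huc.symm hy
    simp only [Finset.mem_erase, SimpleGraph.mem_neighborFinset, this, Finset.mem_insert,
      Finset.mem_sdiff, Finset.mem_univ, Finset.mem_singleton]
    grind

theorem IsBroomOff.degree_center {u c m p : V} (h : IsBroomOff G u c m p) :
    G.degree c + 3 = Fintype.card V + if G.Adj u c then 1 else 0 := by
  rw [G.degree_eq_card_erase_add u c, h.erase_center, Finset.card_insert_of_notMem (by simp)]
  have := h.card_rest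
  omega

theorem IsBroomOff.degree_middle {u c m p : V} (h : IsBroomOff G u c m p) :
    G.degree m = 2 + if G.Adj u m then 1 else 0 := by
  have : (G.neighborFinset m).erase u = {c, p} := by
    ext y
    obtain ⟨huc, hum, hup, hcm, hcp, hmp, adj⟩ := h
    by_cases hy : y = u
    · subst hy; simp [huc, hup]
    · have := adj m y hum.symm hy
      simp only [Finset.mem_erase, SimpleGraph.mem_neighborFinset, this, Finset.mem_insert,
        Finset.mem_singleton]
      grind
  rw [G.degree_eq_card_erase_add u m, this, Finset.card_pair h.hcp]

theorem IsBroomOff.degree_end {u c m p : V} (h : IsBroomOff G u c m p) :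
    G.degree p = 1 + if G.Adj u p then 1 else 0 := by
  have : (G.neighborFinset p).erase u = {m} := by
    ext y
    obtain ⟨huc, hum, hup, hcm, hcp, hmp, adj⟩ := h
    by_cases hy : y = u
    · subst hy; simp [hum]
    · have := adj p y hup.symm hy
      simp only [Finset.mem_erase, SimpleGraph.mem_neighborFinset, this, Finset.mem_singleton]
      grind
  rw [G.degree_eq_card_erase_add u p, this, Finset.card_singleton]

theorem IsBroomOff.degree_leaf {u c m p : V} (h : IsBroomOff G u c m p) {x : V}
    (hx : x ∉ ({u, c, p, m} : Finset V)) : G.degree x = 1 + if G.Adj u x then 1 else 0 := by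
  have : (G.neighborFinset x).erase u = {c} := by
    ext y
    obtain ⟨huc, hum, hup, hcm, hcp, hmp, adj⟩ := h
    simp only [Finset.mem_insert, Finset.mem_singleton, not_or] at hx
    by_cases hy : y = u
    · subst hy; simp [huc]
    · have := adj x y hx.1 hy
      simp only [Finset.mem_erase, SimpleGraph.mem_neighborFinset, this, Finset.mem_singleton]
      grind
  rw [G.degree_eq_card_erase_add u x, this, Finset.card_singleton]

theorem IsBroomOff.filter_edges {u c m p : V} (h : IsBroomOff G u c m p) :
    G.edgeFinset.filter (fun e => u ∉ e ∧ c ∉ e) = {s(m, p)} := by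
  ext e
  obtain ⟨huc, hum, hup, hcm, hcp, hmp, adj⟩ := h
  induction e using Sym2.ind with
  | _ x y =>
    simp only [Finset.mem_filter, SimpleGraph.mem_edgeFinset, SimpleGraph.mem_edgeSet,
      Sym2.mem_iff, not_or, Finset.mem_singleton, Sym2.eq_iff]
    have := adj x y
    constructor
    · rintro ⟨h, ⟨h1, h2⟩, h3, h4⟩
      rw [this (Ne.symm h1) (Ne.symm h2)] at h
      grind
    · rintro (⟨rfl, rfl⟩ | ⟨rfl, rfl⟩)
      · refine ⟨(this hum.symm hup.symm).mpr (by simp), ⟨hum, hup⟩, hcm, hcp⟩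
      · refine ⟨(this hup.symm hum.symm).mpr (by simp), ⟨hup, hum⟩, hcp, hcm⟩

/-- The numerical data of a quasi-tree with apex `u`. -/
structure HasExcess (G : SimpleGraph V) [DecidableRel G.Adj] (u : V) (s : V → ℕ) (n k : ℕ) :
    Prop where
  card : Fintype.card V = n
  degree_apex : G.degree u = k
  degree : ∀ x, x ≠ u → G.degree x = s x + 1 + if G.Adj u x then 1 else 0
  sum : ∑ x ∈ Finset.univ.erase u, s x + 3 = n
  edges : (G.edgeFinset.filter (fun e => u ∉ e)).card + 2 = n

theorem HasExcess.card_erase {u : V} {s : V → ℕ} {n k : ℕ} (h : HasExcess G u s n k) {x : V}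
    (hx : x ≠ u) : ((G.neighborFinset x).erase u).card = s x + 1 := by
  have h1 := h.degree x hx
  rw [G.degree_eq_card_erase_add u x] at h1
  omega

theorem HasExcess.add_le {u : V} {s : V → ℕ} {n k : ℕ} (h : HasExcess G u s n k) {x y : V}
    (hx : x ≠ u) (hy : y ≠ u) (hxy : x ≠ y) : s x + s y + 3 ≤ n := by
  have h1 : ({x, y} : Finset V) ⊆ Finset.univ.erase u := by
    intro z
    simp only [Finset.mem_insert, Finset.mem_singleton, Finset.mem_erase, Finset.mem_univ, and_true]
    rintro (rfl | rfl) <;> assumption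
  have h2 := Finset.sum_le_sum_of_subset (f := s) h1
  rw [Finset.sum_pair hxy] at h2
  have := h.sum
  omega

theorem HasExcess.add_add_le {u : V} {s : V → ℕ} {n k : ℕ} (h : HasExcess G u s n k) {x y z : V}
    (hx : x ≠ u) (hy : y ≠ u) (hz : z ≠ u) (hxy : x ≠ y) (hxz : x ≠ z) (hyz : y ≠ z) :
    s x + s y + s z + 3 ≤ n := by
  have h1 : ({x, y, z} : Finset V) ⊆ Finset.univ.erase u := by
    intro w
    simp only [Finset.mem_insert, Finset.mem_singleton, Finset.mem_erase, Finset.mem_univ, and_true]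
    rintro (rfl | rfl | rfl) <;> assumption
  have h2 := Finset.sum_le_sum_of_subset (f := s) h1
  rw [Finset.sum_insert (by simp [hxy, hxz]), Finset.sum_pair hyz] at h2
  have := h.sum
  omega

/-- The vertex `c` uses the whole budget `n - 3`. It is joined to every other vertex off `u`, and an
edge avoiding `c` would give its ends positive excess. -/
theorem HasExcess.isStarOff {u : V} {s : V → ℕ} {n k : ℕ} (h : HasExcess G u s n k) {c : V}
    (hc : c ≠ u) (hs : s c + 3 = n) : IsStarOff G u c := by
  have hsub : (G.neighborFinset c).erase u ⊆ (Finset.univ.erase u).erase c := by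
    intro y hy
    simp only [Finset.mem_erase, SimpleGraph.mem_neighborFinset] at hy
    simp [hy.1, hy.2.ne']
  have hcard : ((Finset.univ.erase u).erase c).card + 2 = n := by
    rw [Finset.card_erase_of_mem (by simpa using hc), Finset.card_erase_of_mem (by simp),
      Finset.card_univ, h.card]
    omega
  have heq := Finset.eq_of_subset_of_card_le hsub (by rw [h.card_erase hc]; omega)
  have hadj : ∀ y, y ≠ u → y ≠ c → G.Adj c y := by
    intro y hy hyc
    have : y ∈ (G.neighborFinset c).erase u := by rw [heq]; simp [hy, hyc]
    simpa [hy] using this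
  refine ⟨hc.symm, fun x y hx hy => ?_⟩
  by_cases hxc : x = c
  · subst hxc
    simpa using ⟨fun h => h.ne', hadj y hy⟩
  by_cases hyc : y = c
  · subst hyc
    simpa [hxc] using (hadj x hx hxc).symm
  simp only [hxc, hyc, false_and, or_self, iff_false]
  intro hxy
  have h1 := h.card_erase hx
  have h2 := h.add_le hc hx (Ne.symm hxc)
  have h3 : ({c, y} : Finset V) ⊆ (G.neighborFinset x).erase u := by
    intro z
    simp only [Finset.mem_insert, Finset.mem_singleton, Finset.mem_erase,
      SimpleGraph.mem_neighborFinset]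
    rintro (rfl | rfl)
    · exact ⟨hc, (hadj x hx hxc).symm⟩
    · exact ⟨hy, hxy⟩
  have h4 := Finset.card_le_card h3
  rw [Finset.card_pair (Ne.symm hyc)] at h4
  omega

/-- Off `u`, exactly one vertex `p` is not joined to `c`. A neighbour `m` of `p` is joined to `c` as
well, so it takes the one remaining unit of excess; all other vertices are leaves. Counting alone
suffices, without acyclicity. -/
theorem HasExcess.exists_isBroomOff {u : V} {s : V → ℕ} {n k : ℕ} (h : HasExcess G u s n k) {c : V}
    (hc : c ≠ u) (hs : s c + 4 = n) : ∃ m p, IsBroomOff G u c m p := by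
  have hsub : (G.neighborFinset c).erase u ⊆ (Finset.univ.erase u).erase c := by
    intro y hy
    simp only [Finset.mem_erase, SimpleGraph.mem_neighborFinset] at hy
    simp [hy.1, hy.2.ne']
  have hcard : ((Finset.univ.erase u).erase c).card + 2 = n := by
    rw [Finset.card_erase_of_mem (by simpa using hc), Finset.card_erase_of_mem (by simp),
      Finset.card_univ, h.card]
    omega
  have h1 := Finset.card_sdiff_add_card_eq_card hsub
  rw [h.card_erase hc] at h1
  obtain ⟨p, hp⟩ := Finset.card_eq_one.mp (show
    (((Finset.univ.erase u).erase c) \ (G.neighborFinset c).erase u).card = 1 by omega)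
  have hp' : ∀ y, y ≠ u → y ≠ c → (G.Adj c y ↔ y ≠ p) := by
    intro y hy hyc
    have := Finset.ext_iff.mp hp y
    simp only [Finset.mem_sdiff, Finset.mem_erase, Finset.mem_univ,
      SimpleGraph.mem_neighborFinset, Finset.mem_singleton] at this
    grind
  have hpm : p ∈ ((Finset.univ.erase u).erase c) \ (G.neighborFinset c).erase u := by
    rw [hp]; simp
  simp only [Finset.mem_sdiff, Finset.mem_erase, Finset.mem_univ] at hpm
  have hpu : p ≠ u := hpm.1.2.1
  have hpc : p ≠ c := hpm.1.1
  have hcp : ¬ G.Adj c p := by rw [hp' p hpu hpc]; simp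
  have hT := h.card_erase hpu
  obtain ⟨m, hm⟩ := Finset.card_pos.mp (show 0 < ((G.neighborFinset p).erase u).card by omega)
  simp only [Finset.mem_erase, SimpleGraph.mem_neighborFinset] at hm
  obtain ⟨hmu, hpm'⟩ := hm
  have hmp : m ≠ p := hpm'.ne'
  have hmc : m ≠ c := by rintro rfl; exact hcp hpm'.symm
  have hcm : G.Adj c m := (hp' m hmu hmc).mpr hmp
  have hTm := h.card_erase hmu
  have hsm1 : ({c, p} : Finset V) ⊆ (G.neighborFinset m).erase u := by
    intro z
    simp only [Finset.mem_insert, Finset.mem_singleton, Finset.mem_erase,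
      SimpleGraph.mem_neighborFinset]
    rintro (rfl | rfl)
    · exact ⟨hc, hcm.symm⟩
    · exact ⟨hpu, hpm'.symm⟩
  have hsm2 := Finset.card_le_card hsm1
  rw [Finset.card_pair hpc.symm] at hsm2
  have hsm3 := h.add_le hc hmu hmc.symm
  have hTm' := Finset.eq_of_subset_of_card_le hsm1
    (by rw [Finset.card_pair hpc.symm]; omega)
  have hother : ∀ x, x ≠ u → x ≠ c → x ≠ m → s x = 0 := by
    intro x hx hxc hxm
    have := h.add_add_le hc hmu hx hmc.symm hxc.symm hxm.symm
    omega
  have hTp : ∀ y, y ≠ u → (G.Adj p y ↔ y = m) := by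
    intro y hy
    refine ⟨fun hpy => ?_, fun e => e ▸ hpm'⟩
    rw [hother p hpu hpc hmp.symm] at hT
    exact Finset.card_le_one.mp hT.le y (by simpa [hy] using hpy) m (by simpa [hmu] using hpm')
  have hTm'' : ∀ y, y ≠ u → (G.Adj m y ↔ y = c ∨ y = p) := by
    intro y hy
    have := Finset.ext_iff.mp hTm' y
    simp only [Finset.mem_insert, Finset.mem_singleton, Finset.mem_erase,
      SimpleGraph.mem_neighborFinset] at this
    grind
  have hTx : ∀ x y, x ≠ u → x ≠ c → x ≠ m → x ≠ p → y ≠ u → (G.Adj x y ↔ y = c) := by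
    intro x y hx hxc hxm hxp hy
    have hadj := ((hp' x hx hxc).mpr hxp).symm
    refine ⟨fun hxy => ?_, fun e => e ▸ hadj⟩
    have h1 := h.card_erase hx
    rw [hother x hx hxc hxm] at h1
    exact Finset.card_le_one.mp h1.le y (by simpa [hy] using hxy) c (by simpa [hc] using hadj)
  refine ⟨m, p, hc.symm, hmu.symm, hpu.symm, hmc.symm, hpc.symm, hmp, fun x y hx hy => ?_⟩
  by_cases h1 : x = c
  · subst h1
    by_cases h2 : y = x
    · subst h2; simp [hmc.symm, hpc.symm]
    · rw [hp' y hy h2]; grind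
  by_cases h2 : x = m
  · subst h2; rw [hTm'' y hy]; grind
  by_cases h3 : x = p
  · subst h3; rw [hTp y hy]; grind
  · rw [hTx x y hx h1 h2 h3 hy]; grind

end Shapes

/-! ### Bounds for the two parts of the Sombor index -/

section Weights

variable {V : Type*} [Fintype V] [DecidableEq V] (G : SimpleGraph V) [DecidableRel G.Adj]

/-- The contribution of an edge to the Sombor index. -/
noncomputable def edgeWeight (e : Sym2 V) : ℝ :=
  Sym2.lift ⟨fun u v : V => Real.sqrt ((G.degree u : ℝ) ^ 2 + (G.degree v : ℝ) ^ 2),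
    fun _ _ => congrArg Real.sqrt (add_comm _ _)⟩ e

omit [DecidableEq V] in
theorem edgeWeight_mk (x y : V) :
    edgeWeight G s(x, y) = Real.sqrt ((G.degree x : ℝ) ^ 2 + (G.degree y : ℝ) ^ 2) := rfl

theorem sombor_eq_add (u : V) : sombor G =
    ∑ w ∈ G.neighborFinset u, Real.sqrt ((G.degree u : ℝ) ^ 2 + (G.degree w : ℝ) ^ 2) +
      ∑ e ∈ G.edgeFinset.filter (fun e => u ∉ e), edgeWeight G e :=
  G.sum_edgeFinset_eq_add (edgeWeight G) u

variable {G}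

/-- This is `sum_le_of_discrete_convex` with `M = n - 4`: the total excess is at most `M + 1`, and
excluding stars caps each excess at `M`. -/
theorem HasExcess.sum_apex_le {u : V} {s : V → ℕ} {n k : ℕ} (h : HasExcess G u s n k)
    (hn : 5 ≤ n) (hk : 2 ≤ k) (hs : ∀ x, x ≠ u → s x + 4 ≤ n) :
    ∑ w ∈ G.neighborFinset u, Real.sqrt ((G.degree u : ℝ) ^ 2 + (G.degree w : ℝ) ^ 2) ≤
      Real.sqrt ((k : ℝ) ^ 2 + ((n : ℝ) - 2) ^ 2) + Real.sqrt ((k : ℝ) ^ 2 + 9) +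
        ((k : ℝ) - 2) * Real.sqrt ((k : ℝ) ^ 2 + 4) := by
  have hne : ∀ w ∈ G.neighborFinset u, w ≠ u := fun w hw => by
    have : G.Adj u w := by simpa using hw
    exact this.ne'
  have h1 := sum_le_of_discrete_convex
    (fun j : ℕ => Real.sqrt ((k : ℝ) ^ 2 + (2 + (j : ℝ)) ^ 2)) ?_ ?_ (G.neighborFinset u) s (n - 4)
    (by rw [SimpleGraph.card_neighborFinset_eq_degree, h.degree_apex]; exact hk)
    (by
      have h1 : G.neighborFinset u ⊆ Finset.univ.erase u := fun w hw => by simp [hne w hw]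
      have := Finset.sum_le_sum_of_subset (f := s) h1
      have := h.sum
      omega)
    (fun i hi => by have := hs i (hne i hi); omega)
  · rw [SimpleGraph.card_neighborFinset_eq_degree, h.degree_apex] at h1
    refine le_trans (le_of_eq (Finset.sum_congr rfl fun w hw => ?_)) (h1.trans (le_of_eq ?_))
    · have hw' : G.Adj u w := by simpa using hw
      rw [h.degree_apex, h.degree w (hne w hw), if_pos hw']
      push_cast
      ring_nf
    · rw [Nat.cast_sub (show 4 ≤ n by omega)]
      norm_num
      ring_nf
  · intro a p q
    have := sqrt_sq_add_sq_exchange k (2 + a) p q (by positivity) (by positivity)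
    push_cast
    convert this using 3 <;> ring_nf
  · intro a b hab
    have : (a : ℝ) ≤ b := by exact_mod_cast hab
    dsimp only
    gcongr

theorem HasExcess.degree_le {u : V} {s : V → ℕ} {n k : ℕ} (h : HasExcess G u s n k) {x : V}
    (hx : x ≠ u) : G.degree x ≤ s x + 2 := by
  rw [h.degree x hx]
  split_ifs <;> omega

/-- Each of the `n - 2` edges weighs at most `n - 3`: its end degrees are at most `n - 4` and add up
to at most `n + 1`, the extreme pair being `n - 4` and `5`. -/
theorem HasExcess.sum_rest_le_of_small {u : V} {s : V → ℕ} {n k : ℕ} (h : HasExcess G u s n k)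
    (hn : 17 ≤ n) (hs : ∀ x, x ≠ u → s x + 6 ≤ n) :
    ∑ e ∈ G.edgeFinset.filter (fun e => u ∉ e), edgeWeight G e ≤ ((n : ℝ) - 2) * (n - 3) := by
  have hcard : ((G.edgeFinset.filter (fun e => u ∉ e)).card : ℝ) = n - 2 := by
    have : ((G.edgeFinset.filter (fun e => u ∉ e)).card : ℝ) + 2 = n := by exact_mod_cast h.edges
    linarith
  rw [← hcard, ← nsmul_eq_mul]
  refine Finset.sum_le_card_nsmul _ _ _ fun e he => ?_
  induction e using Sym2.ind with
  | _ x y =>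
    simp only [Finset.mem_filter, SimpleGraph.mem_edgeFinset, SimpleGraph.mem_edgeSet,
      Sym2.mem_iff, not_or] at he
    obtain ⟨hxy, h1, h2⟩ := he
    have hx := h.degree_le (Ne.symm h1)
    have hy := h.degree_le (Ne.symm h2)
    have h3 := h.add_le (Ne.symm h1) (Ne.symm h2) hxy.ne
    have h4 := hs x (Ne.symm h1)
    have h5 := hs y (Ne.symm h2)
    rw [edgeWeight_mk]
    have ha : (G.degree x : ℝ) + 4 ≤ n := by exact_mod_cast (show G.degree x + 4 ≤ n by omega)
    have hb : (G.degree y : ℝ) + 4 ≤ n := by exact_mod_cast (show G.degree y + 4 ≤ n by omega)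
    have hab : (G.degree x : ℝ) + G.degree y ≤ n + 1 := by
      exact_mod_cast (show G.degree x + G.degree y ≤ n + 1 by omega)
    have ha0 : (0 : ℝ) ≤ G.degree x := by positivity
    have hb0 : (0 : ℝ) ≤ G.degree y := by positivity
    have hn' : (17 : ℝ) ≤ n := by exact_mod_cast hn
    generalize (G.degree x : ℝ) = a at *
    generalize (G.degree y : ℝ) = b at *
    refine Real.sqrt_le_iff.mpr ⟨by linarith, ?_⟩
    -- The threshold `n - 9` is the reflection of `n + 1` in `n - 4`. Between them, `(n - 4 - a)(n -
    -- 4 - b) ≥ 0` gives `a² + b² ≤ (n - 4)² + (a + b - (n - 4))² ≤ (n - 4)² + 25`. Below it, `a² +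
    -- b² ≤ (a + b)²` is enough.
    rcases le_or_gt ((n : ℝ) - 9) (a + b) with hS | hS
    · nlinarith [mul_nonneg (sub_nonneg.mpr ha) (sub_nonneg.mpr hb),
        mul_nonneg (sub_nonneg.mpr hS) (sub_nonneg.mpr hab)]
    · nlinarith [mul_nonneg ha0 hb0]

/-- Here an edge at `c` may weigh more than `n - 3`, but only slightly, since all other degrees are
at most `4`; the two edges avoiding `c` are light and compensate. -/
theorem HasExcess.sum_rest_le_of_excess_eq {u : V} {s : V → ℕ} {n k : ℕ}
    (h : HasExcess G u s n k) (hn : 23 ≤ n) {c : V} (hc : c ≠ u) (hs : s c + 5 = n) :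
    ∑ e ∈ G.edgeFinset.filter (fun e => u ∉ e), edgeWeight G e ≤ ((n : ℝ) - 2) * (n - 3) := by
  have hn' : (23 : ℝ) ≤ n := by exact_mod_cast hn
  have hdeg : ∀ x, x ≠ u → x ≠ c → (G.degree x : ℝ) ≤ 4 := by
    intro x hx hxc
    have h1 := h.degree_le hx
    have h2 := h.add_le hc hx hxc.symm
    exact_mod_cast (show G.degree x ≤ 4 by omega)
  have hcard := G.sum_edgeFinset_filter_eq_add (fun _ => 1) hc
  simp only [Finset.sum_const, smul_eq_mul, mul_one] at hcard
  rw [h.card_erase hc] at hcard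
  have hedges := h.edges
  have hB : (G.edgeFinset.filter (fun e => u ∉ e ∧ c ∉ e)).card = 2 := by omega
  have hA : (((G.neighborFinset c).erase u).card : ℝ) = n - 4 := by
    rw [h.card_erase hc]
    have : ((s c + 5 : ℕ) : ℝ) = n := by rw [hs]
    push_cast at this ⊢
    linarith
  rw [G.sum_edgeFinset_filter_eq_add (edgeWeight G) hc]
  -- The slack `2/5` works because `(N + 2/5)² ≥ N² + 16` for `N = n - 3 ≥ 20`; this uses `n ≥ 23`.
  have h1 : ∑ w ∈ (G.neighborFinset c).erase u, edgeWeight G s(c, w) ≤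
      ((n : ℝ) - 4) * (n - 3 + 2 / 5) := by
    rw [← hA, ← nsmul_eq_mul]
    refine Finset.sum_le_card_nsmul _ _ _ fun w hw => ?_
    simp only [Finset.mem_erase, SimpleGraph.mem_neighborFinset] at hw
    have h2 := hdeg w hw.1 hw.2.ne'
    have h3 : (G.degree c : ℝ) + 3 ≤ n := by
      have := h.degree_le hc
      exact_mod_cast (show G.degree c + 3 ≤ n by omega)
    have h4 : (G.degree w : ℝ) ^ 2 ≤ 4 ^ 2 := by gcongr
    have h5 : (G.degree c : ℝ) ^ 2 ≤ ((n : ℝ) - 3) ^ 2 := by gcongr; linarith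
    rw [edgeWeight_mk]
    refine Real.sqrt_le_iff.mpr ⟨by linarith, ?_⟩
    nlinarith
  have h2 : ∑ e ∈ G.edgeFinset.filter (fun e => u ∉ e ∧ c ∉ e), edgeWeight G e ≤ 12 := by
    have : (12 : ℝ) = (G.edgeFinset.filter (fun e => u ∉ e ∧ c ∉ e)).card • (6 : ℝ) := by
      rw [hB]; norm_num
    rw [this]
    refine Finset.sum_le_card_nsmul _ _ _ fun e he => ?_
    induction e using Sym2.ind with
    | _ x y =>
      simp only [Finset.mem_filter, SimpleGraph.mem_edgeFinset, SimpleGraph.mem_edgeSet,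
        Sym2.mem_iff, not_or] at he
      obtain ⟨-, ⟨h1, h2⟩, h3, h4⟩ := he
      have h5 := hdeg x (Ne.symm h1) (Ne.symm h3)
      have h6 := hdeg y (Ne.symm h2) (Ne.symm h4)
      have h7 : (G.degree x : ℝ) ^ 2 ≤ 4 ^ 2 := by gcongr
      have h8 : (G.degree y : ℝ) ^ 2 ≤ 4 ^ 2 := by gcongr
      rw [edgeWeight_mk]
      exact Real.sqrt_le_iff.mpr ⟨by norm_num, by linarith⟩
  nlinarith

theorem IsBroomOff.sum_rest_eq {u c m p : V} (h : IsBroomOff G u c m p) :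
    ∑ e ∈ G.edgeFinset.filter (fun e => u ∉ e), edgeWeight G e =
      ∑ w ∈ Finset.univ \ {u, c, p, m},
          Real.sqrt ((G.degree c : ℝ) ^ 2 + (1 + if G.Adj u w then 1 else 0) ^ 2) +
        Real.sqrt ((G.degree c : ℝ) ^ 2 + (2 + if G.Adj u m then 1 else 0) ^ 2) +
        Real.sqrt ((2 + if G.Adj u m then 1 else 0) ^ 2 + (1 + if G.Adj u p then 1 else 0) ^ 2) := by
  rw [G.sum_edgeFinset_filter_eq_add (edgeWeight G) h.huc.symm, h.erase_center, h.filter_edges,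
    Finset.sum_insert (by simp), Finset.sum_singleton]
  simp only [edgeWeight_mk, h.degree_middle, h.degree_end]
  have hleaf : ∑ w ∈ Finset.univ \ {u, c, p, m},
      Real.sqrt ((G.degree c : ℝ) ^ 2 + (G.degree w : ℝ) ^ 2) =
        ∑ w ∈ Finset.univ \ {u, c, p, m},
          Real.sqrt ((G.degree c : ℝ) ^ 2 + (1 + if G.Adj u w then 1 else 0) ^ 2) := by
    refine Finset.sum_congr rfl fun w hw => ?_
    rw [h.degree_leaf (Finset.mem_sdiff.mp hw).2]
    push_cast
    rfl
  rw [hleaf]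
  push_cast
  ring

theorem IsBroomOff.card_filter_rest {u c m p : V} (h : IsBroomOff G u c m p) :
    ((Finset.univ \ {u, c, p, m}).filter (G.Adj u ·)).card + (if G.Adj u c then 1 else 0) +
      (if G.Adj u m then 1 else 0) + (if G.Adj u p then 1 else 0) = G.degree u := by
  have : (Finset.univ \ {u, c, p, m}).filter (G.Adj u ·) =
      (((G.neighborFinset u).erase c).erase m).erase p := by
    ext w
    simp only [Finset.mem_filter, Finset.mem_sdiff, Finset.mem_univ, Finset.mem_insert,
      Finset.mem_singleton, Finset.mem_erase, SimpleGraph.mem_neighborFinset]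
    have : G.Adj u w → w ≠ u := fun h => h.ne'
    grind
  rw [this, ← SimpleGraph.card_neighborFinset_eq_degree]
  have h1 := Finset.card_erase_eq_ite (s := ((G.neighborFinset u).erase c).erase m) (a := p)
  have h2 := Finset.card_erase_eq_ite (s := (G.neighborFinset u).erase c) (a := m)
  have h3 := Finset.card_erase_eq_ite (s := G.neighborFinset u) (a := c)
  have e1 : p ∈ ((G.neighborFinset u).erase c).erase m ↔ G.Adj u p := by
    simp [h.hcp.symm, h.hmp.symm]
  have e2 : m ∈ (G.neighborFinset u).erase c ↔ G.Adj u m := by simp [h.hcm.symm]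
  have e3 : c ∈ G.neighborFinset u ↔ G.Adj u c := by simp
  have p1 : G.Adj u p → 0 < (((G.neighborFinset u).erase c).erase m).card :=
    fun h => Finset.card_pos.mpr ⟨p, e1.mpr h⟩
  have p2 : G.Adj u m → 0 < ((G.neighborFinset u).erase c).card :=
    fun h => Finset.card_pos.mpr ⟨m, e2.mpr h⟩
  have p3 : G.Adj u c → 0 < (G.neighborFinset u).card :=
    fun h => Finset.card_pos.mpr ⟨c, e3.mpr h⟩
  simp only [e1] at h1
  simp only [e2] at h2
  simp only [e3] at h3
  split_ifs at * <;> grind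

theorem IsBroomOff.sum_leaves_eq {u c m p : V} (h : IsBroomOff G u c m p) (C : ℝ) :
    ∑ w ∈ Finset.univ \ {u, c, p, m},
        Real.sqrt (C ^ 2 + (1 + if G.Adj u w then 1 else 0) ^ 2) =
      ((G.degree u : ℝ) - (if G.Adj u c then 1 else 0) - (if G.Adj u m then 1 else 0) -
          (if G.Adj u p then 1 else 0)) * Real.sqrt (C ^ 2 + 4) +
        ((Fintype.card V : ℝ) - 4 - ((G.degree u : ℝ) - (if G.Adj u c then 1 else 0) -
          (if G.Adj u m then 1 else 0) - (if G.Adj u p then 1 else 0))) *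
          Real.sqrt (C ^ 2 + 1) := by
  have hq : ((Finset.univ \ {u, c, p, m} : Finset V).card : ℝ) = Fintype.card V - 4 := by
    have := h.card_rest
    rw [← this]; push_cast; ring
  have hr : (((Finset.univ \ {u, c, p, m}).filter (G.Adj u ·)).card : ℝ) =
      (G.degree u : ℝ) - (if G.Adj u c then 1 else 0) - (if G.Adj u m then 1 else 0) -
          (if G.Adj u p then 1 else 0) := by
    rw [← h.card_filter_rest]; push_cast; ring
  have hsplit := Finset.card_filter_add_card_filter_not
    (s := (Finset.univ \ {u, c, p, m} : Finset V)) (G.Adj u ·)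
  have hr' : (((Finset.univ \ {u, c, p, m}).filter (¬ G.Adj u ·)).card : ℝ) =
      (Fintype.card V : ℝ) - 4 - ((G.degree u : ℝ) - (if G.Adj u c then 1 else 0) -
        (if G.Adj u m then 1 else 0) - (if G.Adj u p then 1 else 0)) := by
    rw [← hr, ← hq, ← hsplit]; push_cast; ring
  rw [← hr', ← hr, ← Finset.sum_filter_add_sum_filter_not _ (G.Adj u ·), ← nsmul_eq_mul,
    ← nsmul_eq_mul, ← Finset.sum_const, ← Finset.sum_const]
  congr 1
  · refine Finset.sum_congr rfl fun w hw => ?_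
    rw [if_pos (Finset.mem_filter.mp hw).2]
    norm_num
  · refine Finset.sum_congr rfl fun w hw => ?_
    rw [if_neg (Finset.mem_filter.mp hw).2]
    norm_num

/-- The part of `phiPrime n k` that comes from the edges avoiding the apex. -/
noncomputable def restBound (n k : ℕ) : ℝ :=
  ((k : ℝ) - 3) * Real.sqrt (((n : ℝ) - 2) ^ 2 + 4)
    + ((n : ℝ) - k - 1) * Real.sqrt (((n : ℝ) - 2) ^ 2 + 1)
    + Real.sqrt (((n : ℝ) - 2) ^ 2 + 9) + Real.sqrt 13

/-- The coefficients of the roots containing `n - 2` add up to `n - 3`, each such root is at least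
`n - 2`, and `√13` makes the inequality strict. -/
theorem lt_restBound {n k : ℕ} (hk : 3 ≤ k) (hkn : k + 1 ≤ n) :
    ((n : ℝ) - 2) * (n - 3) < restBound n k := by
  have hk' : (3 : ℝ) ≤ k := by exact_mod_cast hk
  have hkn' : (k : ℝ) + 1 ≤ n := by exact_mod_cast hkn
  have h (a : ℝ) (ha : 0 ≤ a) : (n : ℝ) - 2 ≤ Real.sqrt (((n : ℝ) - 2) ^ 2 + a) :=
    Real.le_sqrt_of_sq_le (by linarith)
  have h1 := mul_le_mul_of_nonneg_left (h 4 (by norm_num)) (sub_nonneg.mpr hk')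
  have h2 := mul_le_mul_of_nonneg_left (h 1 (by norm_num)) (sub_nonneg.mpr hkn')
  have h3 := h 9 (by norm_num)
  have h4 : 0 < Real.sqrt 13 := by positivity
  unfold restBound
  nlinarith

theorem IsBroomOff.sum_rest_le {u c m p : V} {n k : ℕ} (h : IsBroomOff G u c m p)
    (hn : 23 ≤ n) (hk : 4 ≤ k) (hkn : k + 2 ≤ n) (hV : Fintype.card V = n)
    (hu : G.degree u = k) :
    ∑ e ∈ G.edgeFinset.filter (fun e => u ∉ e), edgeWeight G e ≤ restBound n k ∧
    (∑ e ∈ G.edgeFinset.filter (fun e => u ∉ e), edgeWeight G e = restBound n k ↔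
      G.Adj u c ∧ G.Adj u m ∧ G.Adj u p) := by
  rw [h.sum_rest_eq, h.sum_leaves_eq, hu, hV]
  have hn' : (23 : ℝ) ≤ n := by exact_mod_cast hn
  have hk' : (4 : ℝ) ≤ k := by exact_mod_cast hk
  have hkn' : (k : ℝ) + 2 ≤ n := by exact_mod_cast hkn
  have hC := h.degree_center
  rw [hV] at hC
  have h13 : (3.6 : ℝ) < Real.sqrt 13 := Real.lt_sqrt_of_sq_lt (by norm_num)
  have h13' : Real.sqrt 13 < 3.7 := (Real.sqrt_lt' (by norm_num)).mpr (by norm_num)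
  have h10 : Real.sqrt 10 < 3.2 := (Real.sqrt_lt' (by norm_num)).mpr (by norm_num)
  have h8 : Real.sqrt 8 < 2.9 := (Real.sqrt_lt' (by norm_num)).mpr (by norm_num)
  have h5 : Real.sqrt 5 < 2.3 := (Real.sqrt_lt' (by norm_num)).mpr (by norm_num)
  by_cases hc : G.Adj u c
  · have hC' : (G.degree c : ℝ) = n - 2 := by
      rw [if_pos hc] at hC
      have : ((G.degree c + 3 : ℕ) : ℝ) = (n + 1 : ℕ) := by rw [hC]
      push_cast at this
      linarith
    rw [hC']
    -- If `u` misses `m` or `p`, it is joined to one or two more leaves, each gaining at most `0.1`.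
    -- The edge `mp` then drops from `√13` to at most `√10`, which loses more than that.
    have hgap : Real.sqrt (((n : ℝ) - 2) ^ 2 + 4) ≤ Real.sqrt (((n : ℝ) - 2) ^ 2 + 1) + 0.1 := by
      have h1 : (n : ℝ) - 2 ≤ Real.sqrt (((n : ℝ) - 2) ^ 2 + 1) :=
        Real.le_sqrt_of_sq_le (by linarith)
      have h2 := Real.sq_sqrt (show 0 ≤ ((n : ℝ) - 2) ^ 2 + 1 by positivity)
      refine Real.sqrt_le_iff.mpr ⟨by positivity, ?_⟩
      nlinarith
    have hmono : Real.sqrt (((n : ℝ) - 2) ^ 2 + 4) ≤ Real.sqrt (((n : ℝ) - 2) ^ 2 + 9) := by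
      gcongr; norm_num
    unfold restBound
    by_cases hm : G.Adj u m <;> by_cases hp : G.Adj u p <;>
      simp only [hc, hm, hp, if_true, if_false, and_true, and_false, iff_false, iff_true]
    · norm_num
      constructor
      · linarith
      · ring
    all_goals norm_num
    all_goals refine ⟨?_, ne_of_lt ?_⟩ <;> nlinarith
  · have hC' : (G.degree c : ℝ) = n - 3 := by
      rw [if_neg hc] at hC
      have : ((G.degree c + 3 : ℕ) : ℝ) = (n + 0 : ℕ) := by rw [hC]
      push_cast at this
      linarith
    rw [hC']
    simp only [hc, false_and, iff_false, if_false]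
    suffices hlt : _ < restBound n k from ⟨hlt.le, hlt.ne⟩
    set r : ℝ := (k : ℝ) - 0 - (if G.Adj u m then 1 else 0) - (if G.Adj u p then 1 else 0) with hr
    have hrest : ((Finset.univ \ {u, c, p, m}).filter (G.Adj u ·)).card ≤ n - 4 := by
      have h1 := Finset.card_filter_le (Finset.univ \ {u, c, p, m}) (G.Adj u ·)
      have h2 := h.card_rest
      omega
    have hr4 : r ≤ (n : ℝ) - 4 := by
      have h1 := h.card_filter_rest
      have h2 : r = ((Finset.univ \ {u, c, p, m}).filter (G.Adj u ·)).card := by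
        rw [hr, ← hu, ← h1, if_neg hc]; push_cast; ring
      rw [h2]
      have : ((n - 4 : ℕ) : ℝ) = n - 4 := by rw [Nat.cast_sub (by omega)]; norm_num
      rw [← this]
      exact_mod_cast hrest
    -- Without the edge `uc` the degree of `c` drops by one, and even the heaviest edge from `c` to
    -- a leaf is lighter than the lightest one in `restBound`.
    have hs1 : Real.sqrt (((n : ℝ) - 3) ^ 2 + 4) < Real.sqrt (((n : ℝ) - 2) ^ 2 + 1) := by
      apply Real.sqrt_lt_sqrt (by positivity); nlinarith
    have hs2 : Real.sqrt (((n : ℝ) - 3) ^ 2 + 1) ≤ Real.sqrt (((n : ℝ) - 3) ^ 2 + 4) := by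
      gcongr; norm_num
    have hs3 : Real.sqrt (((n : ℝ) - 2) ^ 2 + 1) ≤ Real.sqrt (((n : ℝ) - 2) ^ 2 + 4) := by
      gcongr; norm_num
    have hs4 : Real.sqrt (((n : ℝ) - 3) ^ 2 + (2 + if G.Adj u m then 1 else 0) ^ 2) ≤
        Real.sqrt (((n : ℝ) - 2) ^ 2 + 9) := by
      apply Real.sqrt_le_sqrt; split_ifs <;> nlinarith
    have hs5 : Real.sqrt ((2 + if G.Adj u m then 1 else 0) ^ 2 +
        (1 + if G.Adj u p then 1 else 0) ^ 2) ≤ Real.sqrt 13 := by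
      apply Real.sqrt_le_sqrt; split_ifs <;> norm_num
    have t1 := mul_le_mul_of_nonneg_left hs2 (sub_nonneg.mpr hr4)
    have t2 := mul_lt_mul_of_pos_left hs1 (show (0 : ℝ) < n - 4 by linarith)
    have t3 := mul_le_mul_of_nonneg_left hs3 (show (0 : ℝ) ≤ k - 3 by linarith)
    unfold restBound
    linarith

theorem IsBroomOff.sum_apex_eq {u c m p : V} {n k : ℕ} (h : IsBroomOff G u c m p)
    (hV : Fintype.card V = n) (hu : G.degree u = k) (hc : G.Adj u c) (hm : G.Adj u m)
    (hp : G.Adj u p) :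
    ∑ w ∈ G.neighborFinset u, Real.sqrt ((G.degree u : ℝ) ^ 2 + (G.degree w : ℝ) ^ 2) =
      Real.sqrt ((k : ℝ) ^ 2 + ((n : ℝ) - 2) ^ 2) + Real.sqrt ((k : ℝ) ^ 2 + 9) +
        ((k : ℝ) - 2) * Real.sqrt ((k : ℝ) ^ 2 + 4) := by
  have hN : G.neighborFinset u =
      insert c (insert m (insert p ((Finset.univ \ {u, c, p, m}).filter (G.Adj u ·)))) := by
    ext w
    simp only [Finset.mem_filter, Finset.mem_sdiff, Finset.mem_univ, Finset.mem_insert,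
      Finset.mem_singleton, SimpleGraph.mem_neighborFinset]
    have : G.Adj u w → w ≠ u := fun h => h.ne'
    grind
  have hcard := h.card_filter_rest
  rw [if_pos hc, if_pos hm, if_pos hp, hu] at hcard
  have hcard' : (((Finset.univ \ {u, c, p, m}).filter (G.Adj u ·)).card : ℝ) = k - 3 := by
    rw [← hcard]; push_cast; ring
  have hC := h.degree_center
  rw [if_pos hc, hV] at hC
  have hC' : (G.degree c : ℝ) = n - 2 := by
    have : ((G.degree c + 3 : ℕ) : ℝ) = (n + 1 : ℕ) := by rw [hC]
    push_cast at this
    linarith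
  rw [hN, Finset.sum_insert (by simp [h.hcm, h.hcp]), Finset.sum_insert (by simp [h.hmp]),
    Finset.sum_insert (by simp), hu, hC', h.degree_middle, h.degree_end, if_pos hm, if_pos hp]
  have : ∑ w ∈ (Finset.univ \ {u, c, p, m}).filter (G.Adj u ·),
      Real.sqrt ((k : ℝ) ^ 2 + (G.degree w : ℝ) ^ 2) =
        ((k : ℝ) - 3) * Real.sqrt ((k : ℝ) ^ 2 + 4) := by
    rw [← hcard', ← nsmul_eq_mul, ← Finset.sum_const]
    refine Finset.sum_congr rfl fun w hw => ?_
    rw [Finset.mem_filter, Finset.mem_sdiff] at hw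
    rw [h.degree_leaf hw.1.2, if_pos hw.2]
    norm_num
  rw [this]
  norm_num
  ring

theorem phiPrime_eq (n k : ℕ) : phiPrime n k =
    (Real.sqrt ((k : ℝ) ^ 2 + ((n : ℝ) - 2) ^ 2) + Real.sqrt ((k : ℝ) ^ 2 + 9) +
        ((k : ℝ) - 2) * Real.sqrt ((k : ℝ) ^ 2 + 4)) + restBound n k := by
  unfold phiPrime restBound
  ring

end Weights

/-! ### Uniqueness of the extremal shapes up to isomorphism -/

section Isomorphisms

variable {V W : Type*} [Fintype V] [Fintype W] [DecidableEq V] [DecidableEq W]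
  {G : SimpleGraph V} {H : SimpleGraph W} [DecidableRel G.Adj] [DecidableRel H.Adj]

/-- The colouring of a graph with apex `u` and star centre `c`. -/
def starColor (G : SimpleGraph V) [DecidableRel G.Adj] (u c x : V) : Fin 4 :=
  if x = u then 0 else if x = c then 1 else if G.Adj u x then 2 else 3

/-- The colour adjacency of `starColor`; `P` says whether the apex and the centre are joined. -/
def starColorAdj (P : Prop) (i j : Fin 4) : Prop :=
  (P ∧ ((i = 0 ∧ j = 1) ∨ (i = 1 ∧ j = 0))) ∨ (i = 0 ∧ j = 2) ∨ (i = 2 ∧ j = 0) ∨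
    (i = 1 ∧ j = 2) ∨ (i = 2 ∧ j = 1) ∨ (i = 1 ∧ j = 3) ∨ (i = 3 ∧ j = 1)

omit [Fintype V] in
theorem IsStarOff.adj_iff_starColorAdj {u c : V} (h : IsStarOff G u c) (x y : V) :
    G.Adj x y ↔ starColorAdj (G.Adj u c) (starColor G u c x) (starColor G u c y) := by
  obtain ⟨huc, adj⟩ := h
  have h1 := adj x y
  have h2 := G.adj_comm x y
  have h3 : ¬ G.Adj u u := G.loopless.irrefl u
  unfold starColorAdj starColor
  by_cases hx : x = u
  · subst hx
    by_cases hy : y = x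
    · subst hy; simp
    by_cases hyc : y = c
    · subst hyc; simp [hy]
    by_cases ha : G.Adj x y <;> simp [hy, hyc, ha]
  by_cases hy : y = u
  · subst hy
    by_cases hxc : x = c
    · subst hxc; simp [hx, h2]
    by_cases ha : G.Adj y x <;> simp [hx, hxc, ha, h2]
  rw [h1 hx hy]
  by_cases hxc : x = c <;> by_cases hyc : y = c <;> by_cases ha : G.Adj u x <;>
    by_cases hb : G.Adj u y <;> simp [hx, hy, hxc, hyc, ha, hb, huc.symm]

/-- The class sizes depend only on the order, the degree of `u` and whether `u` and `c` are joined;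
hence these data determine the graph. -/
theorem IsStarOff.card_starColor {u c : V} (h : IsStarOff G u c) (i : Fin 4) :
    (Finset.univ.filter fun x => starColor G u c x = i).card =
      ![1, 1, G.degree u - (if G.Adj u c then 1 else 0),
        Fintype.card V - 2 - (G.degree u - (if G.Adj u c then 1 else 0))] i := by
  have h2 : (Finset.univ.filter fun x => starColor G u c x = 2) = (G.neighborFinset u).erase c := by
    ext x
    have : G.Adj u x → x ≠ u := fun h => h.ne'
    rw [Finset.mem_filter_univ]
    simp only [starColor, Finset.mem_erase,
      SimpleGraph.mem_neighborFinset]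
    split_ifs <;> simp_all
  have h2' : ((G.neighborFinset u).erase c).card =
      G.degree u - (if G.Adj u c then 1 else 0) := by
    rw [Finset.card_erase_eq_ite, SimpleGraph.card_neighborFinset_eq_degree]
    simp only [SimpleGraph.mem_neighborFinset]
    split_ifs <;> simp
  have h0 : (Finset.univ.filter fun x => starColor G u c x = 0) = {u} := by
    ext x
    rw [Finset.mem_filter_univ]
    simp only [starColor, Finset.mem_singleton]
    split_ifs <;> simp_all
  have h1 : (Finset.univ.filter fun x => starColor G u c x = 1) = {c} := by
    ext x
    have := h.huc
    rw [Finset.mem_filter_univ]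
    simp only [starColor, Finset.mem_singleton]
    split_ifs <;> simp_all
  have hsum := Finset.card_eq_sum_card_fiberwise (f := starColor G u c) (s := Finset.univ)
    (t := Finset.univ) (fun _ _ => Finset.mem_coe.mpr (Finset.mem_univ _))
  rw [Fin.sum_univ_four, h0, h1, h2, h2', Finset.card_univ] at hsum
  fin_cases i
  · simpa using congrArg Finset.card h0
  · simpa using congrArg Finset.card h1
  · simpa [h2'] using congrArg Finset.card h2
  · simp at hsum ⊢
    omega

theorem IsStarOff.nonempty_iso {u c : V} {u' c' : W} (hG : IsStarOff G u c)
    (hH : IsStarOff H u' c') (hcard : Fintype.card V = Fintype.card W)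
    (hdeg : G.degree u = H.degree u') (hadj : G.Adj u c ↔ H.Adj u' c') : Nonempty (G ≃g H) := by
  refine nonempty_iso_of_coloring G H (starColorAdj (G.Adj u c)) _
    (starColor H u' c') hG.adj_iff_starColorAdj
    (fun x y => ?_) fun i => ?_
  · rw [hadj]; exact hH.adj_iff_starColorAdj x y
  · rw [hG.card_starColor, hH.card_starColor]
    simp only [hcard, hdeg, hadj]

/-- The colouring of a graph with apex `u` and a broom `c`, `m`, `p`. -/
def broomColor (G : SimpleGraph V) [DecidableRel G.Adj] (u c m p x : V) : Fin 6 :=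
  if x = u then 0 else if x = c then 1 else if x = m then 2 else if x = p then 3 else
    if G.Adj u x then 4 else 5

/-- The colour adjacency of `broomColor` when the apex is joined to `c`, `m` and `p`. -/
def broomColorAdj (i j : Fin 6) : Prop :=
  (i, j) ∈ ([(0, 1), (1, 0), (0, 2), (2, 0), (0, 3), (3, 0), (0, 4), (4, 0), (1, 2), (2, 1), (1, 4),
    (4, 1), (1, 5), (5, 1), (2, 3), (3, 2)] : List (Fin 6 × Fin 6))

theorem broomColorAdj_symm {i j : Fin 6} : broomColorAdj i j → broomColorAdj j i := by
  revert i j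
  unfold broomColorAdj
  decide

omit [Fintype V] in
theorem broomColor_cases (G : SimpleGraph V) [DecidableRel G.Adj] (u c m p : V) {x : V}
    (hx : x ≠ u) : (x = c ∧ broomColor G u c m p x = 1) ∨
      (x ≠ c ∧ x = m ∧ broomColor G u c m p x = 2) ∨
      (x ≠ c ∧ x ≠ m ∧ x = p ∧ broomColor G u c m p x = 3) ∨
      (x ≠ c ∧ x ≠ m ∧ x ≠ p ∧ (broomColor G u c m p x = 4 ∧ G.Adj u x ∨
        broomColor G u c m p x = 5 ∧ ¬ G.Adj u x)) := by
  unfold broomColor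
  split_ifs <;> simp_all

omit [Fintype V] in
theorem IsBroomOff.adj_iff_broomColorAdj {u c m p : V} (h : IsBroomOff G u c m p)
    (hc : G.Adj u c) (hm : G.Adj u m) (hp : G.Adj u p) (x y : V) :
    G.Adj x y ↔ broomColorAdj (broomColor G u c m p x) (broomColor G u c m p y) := by
  obtain ⟨huc, hum, hup, hcm, hcp, hmp, adj⟩ := h
  have hu : broomColor G u c m p u = 0 := if_pos rfl
  have key : ∀ y, G.Adj u y ↔
      broomColorAdj (broomColor G u c m p u) (broomColor G u c m p y) := by
    intro y
    rw [hu]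
    by_cases hy : y = u
    · subst hy
      simp only [SimpleGraph.irrefl, hu, false_iff]
      unfold broomColorAdj; decide
    rcases broomColor_cases G u c m p hy with ⟨rfl, e⟩ | ⟨-, rfl, e⟩ | ⟨-, -, rfl, e⟩ |
        ⟨-, -, -, ⟨e, h⟩ | ⟨e, h⟩⟩ <;> simp only [*, true_iff, false_iff] <;>
      unfold broomColorAdj <;> decide
  by_cases hx : x = u
  · subst hx; exact key y
  by_cases hy : y = u
  · subst hy
    rw [G.adj_comm, key x]
    exact ⟨broomColorAdj_symm, broomColorAdj_symm⟩
  rw [adj x y hx hy]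
  rcases broomColor_cases G u c m p hx with ⟨x1, e⟩ | ⟨x1, x2, e⟩ | ⟨x1, x2, x3, e⟩ |
      ⟨x1, x2, x3, ⟨e, -⟩ | ⟨e, -⟩⟩ <;>
    rcases broomColor_cases G u c m p hy with ⟨y1, f⟩ | ⟨y1, y2, f⟩ | ⟨y1, y2, y3, f⟩ |
      ⟨y1, y2, y3, ⟨f, -⟩ | ⟨f, -⟩⟩ <;>
    rw [e, f] <;> simp only [*, broomColorAdj, List.mem_cons, Prod.mk.injEq] <;> simp [*, Ne.symm]

theorem IsBroomOff.card_broomColor {u c m p : V} (h : IsBroomOff G u c m p)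
    (hc : G.Adj u c) (hm : G.Adj u m) (hp : G.Adj u p) (i : Fin 6) :
    (Finset.univ.filter fun x => broomColor G u c m p x = i).card =
      ![1, 1, 1, 1, G.degree u - 3, Fintype.card V - 4 - (G.degree u - 3)] i := by
  have hrest := h.card_filter_rest
  rw [if_pos hc, if_pos hm, if_pos hp] at hrest
  obtain ⟨huc, hum, hup, hcm, hcp, hmp, adj⟩ := h
  have h0 : (Finset.univ.filter fun x => broomColor G u c m p x = 0) = {u} := by
    ext x
    rw [Finset.mem_filter_univ]
    simp only [broomColor, Finset.mem_singleton]
    split_ifs <;> simp_all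
  have h1 : (Finset.univ.filter fun x => broomColor G u c m p x = 1) = {c} := by
    ext x
    rw [Finset.mem_filter_univ]
    simp only [broomColor, Finset.mem_singleton]
    split_ifs <;> simp_all
  have h2 : (Finset.univ.filter fun x => broomColor G u c m p x = 2) = {m} := by
    ext x
    rw [Finset.mem_filter_univ]
    simp only [broomColor, Finset.mem_singleton]
    split_ifs <;> simp_all
  have h3 : (Finset.univ.filter fun x => broomColor G u c m p x = 3) = {p} := by
    ext x
    rw [Finset.mem_filter_univ]
    simp only [broomColor, Finset.mem_singleton]
    split_ifs <;> simp_all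
  have h4 : (Finset.univ.filter fun x => broomColor G u c m p x = 4) =
      (Finset.univ \ {u, c, p, m}).filter (G.Adj u ·) := by
    ext x
    rw [Finset.mem_filter_univ]
    simp only [broomColor, Finset.mem_filter, Finset.mem_univ, true_and, Finset.mem_sdiff,
      Finset.mem_insert, Finset.mem_singleton]
    split_ifs <;> simp_all
  have hsum := Finset.card_eq_sum_card_fiberwise (f := broomColor G u c m p) (s := Finset.univ)
    (t := Finset.univ) (fun _ _ => Finset.mem_coe.mpr (Finset.mem_univ _))
  rw [Fin.sum_univ_six, h0, h1, h2, h3, h4, Finset.card_univ] at hsum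
  have h4' := congrArg Finset.card h4
  fin_cases i
  · simpa using congrArg Finset.card h0
  · simpa using congrArg Finset.card h1
  · simpa using congrArg Finset.card h2
  · simpa using congrArg Finset.card h3
  · simp at h4' ⊢
    omega
  · simp at hsum ⊢
    omega

theorem IsBroomOff.nonempty_iso {u c m p : V} {u' c' m' p' : W} (hG : IsBroomOff G u c m p)
    (hH : IsBroomOff H u' c' m' p') (hcard : Fintype.card V = Fintype.card W)
    (hdeg : G.degree u = H.degree u') (hc : G.Adj u c) (hm : G.Adj u m) (hp : G.Adj u p)
    (hc' : H.Adj u' c') (hm' : H.Adj u' m') (hp' : H.Adj u' p') : Nonempty (G ≃g H) := by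
  refine nonempty_iso_of_coloring G H broomColorAdj _ _ (hG.adj_iff_broomColorAdj hc hm hp)
    (hH.adj_iff_broomColorAdj hc' hm' hp') fun i => ?_
  rw [hG.card_broomColor hc hm hp, hH.card_broomColor hc' hm' hp', hcard, hdeg]

end Isomorphisms

/-! ### The three named families as stars and brooms -/

section Families

theorem Finset.card_eq_card_of_val_mem_iff {n : ℕ} (S : Finset ℕ) (hS : ∀ i ∈ S, i < n)
    (T : Finset (Fin n)) (hT : ∀ i : Fin n, i ∈ T ↔ i.val ∈ S) : T.card = S.card := by
  rw [← Finset.card_map Fin.valEmbedding]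
  congr 1
  ext i
  simp only [Finset.mem_map, Fin.valEmbedding_apply]
  exact ⟨fun ⟨j, hj, e⟩ => e ▸ (hT j).mp hj, fun hi => ⟨⟨i, hS i hi⟩, (hT _).mpr hi, rfl⟩⟩

theorem graphQ_isStarOff {n k : ℕ} (hn : 2 ≤ n) :
    IsStarOff (graphQ n k) ⟨1, by omega⟩ ⟨0, by omega⟩ := by
  refine ⟨by simp, fun x y hx hy => ?_⟩
  simp only [graphQ, SimpleGraph.fromRel_adj, ne_eq, Fin.ext_iff] at *
  omega

theorem graphQ_degree {n k : ℕ} (hn : 2 ≤ n) (hk : 1 ≤ k) (hkn : k + 1 ≤ n)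
    [DecidableRel (graphQ n k).Adj] : (graphQ n k).degree ⟨1, by omega⟩ = k := by
  rw [← SimpleGraph.card_neighborFinset_eq_degree,
    Finset.card_eq_card_of_val_mem_iff (insert 0 (Finset.Icc 2 k))]
  · rw [Finset.card_insert_of_notMem (by simp), Nat.card_Icc]; omega
  · simp only [Finset.mem_insert, Finset.mem_Icc]; omega
  · intro i
    rw [SimpleGraph.mem_neighborFinset]
    simp only [graphQ, SimpleGraph.fromRel_adj, ne_eq, Fin.ext_iff,
      Finset.mem_insert, Finset.mem_Icc, true_and]
    omega

theorem graphQStar_isStarOff {n k : ℕ} (hn : 2 ≤ n) :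
    IsStarOff (graphQStar n k) ⟨1, by omega⟩ ⟨0, by omega⟩ := by
  refine ⟨by simp, fun x y hx hy => ?_⟩
  simp only [graphQStar, SimpleGraph.fromRel_adj, ne_eq, Fin.ext_iff] at *
  omega

theorem graphQStar_degree {n k : ℕ} (hn : 2 ≤ n) (hkn : k + 2 ≤ n)
    [DecidableRel (graphQStar n k).Adj] : (graphQStar n k).degree ⟨1, by omega⟩ = k := by
  rw [← SimpleGraph.card_neighborFinset_eq_degree,
    Finset.card_eq_card_of_val_mem_iff (Finset.Icc 2 (k + 1))]
  · rw [Nat.card_Icc]; omega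
  · simp only [Finset.mem_Icc]; omega
  · intro i
    rw [SimpleGraph.mem_neighborFinset]
    simp only [graphQStar, SimpleGraph.fromRel_adj, ne_eq,
      Fin.ext_iff, Finset.mem_Icc, true_and]
    omega

theorem graphQPrime_isBroomOff {n k : ℕ} (hn : 4 ≤ n) :
    IsBroomOff (graphQPrime n k) ⟨1, by omega⟩ ⟨0, by omega⟩ ⟨2, by omega⟩ ⟨n - 1, by omega⟩ := by
  refine ⟨by simp, by simp, ?_, by simp, ?_, ?_, fun x y hx hy => ?_⟩
  · simp only [ne_eq, Fin.ext_iff]; omega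
  · simp only [ne_eq, Fin.ext_iff]; omega
  · simp only [ne_eq, Fin.ext_iff]; omega
  have := x.isLt
  have := y.isLt
  simp only [graphQPrime, SimpleGraph.fromRel_adj, ne_eq, Fin.ext_iff] at *
  omega

theorem graphQPrime_degree {n k : ℕ} (hk : 3 ≤ k) (hkn : k + 1 ≤ n)
    [DecidableRel (graphQPrime n k).Adj] : (graphQPrime n k).degree ⟨1, by omega⟩ = k := by
  rw [← SimpleGraph.card_neighborFinset_eq_degree,
    Finset.card_eq_card_of_val_mem_iff (insert 0 (insert (n - 1) (Finset.Icc 2 (k - 1))))]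
  · rw [Finset.card_insert_of_notMem, Finset.card_insert_of_notMem, Nat.card_Icc]
    · omega
    · simp only [Finset.mem_Icc]; omega
    · simp only [Finset.mem_insert, Finset.mem_Icc]; omega
  · simp only [Finset.mem_insert, Finset.mem_Icc]; omega
  · intro i
    have := i.isLt
    rw [SimpleGraph.mem_neighborFinset]
    simp only [graphQPrime, SimpleGraph.fromRel_adj, ne_eq,
      Fin.ext_iff, Finset.mem_insert, Finset.mem_Icc, true_and, true_or, and_true]
    omega

theorem graphQPrime_adj {n k : ℕ} (hk : 3 ≤ k) (hkn : k + 1 ≤ n) :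
    (graphQPrime n k).Adj ⟨1, by omega⟩ ⟨0, by omega⟩ ∧
    (graphQPrime n k).Adj ⟨1, by omega⟩ ⟨2, by omega⟩ ∧
    (graphQPrime n k).Adj ⟨1, by omega⟩ ⟨n - 1, by omega⟩ := by
  simp only [graphQPrime, SimpleGraph.fromRel_adj, ne_eq, Fin.ext_iff, true_and, true_or,
    or_true, and_true]
  omega

/-- Pulling the broom back to `G` lets the value of the index be computed on any copy of
`graphQPrime`. -/
theorem IsBroomOff.of_iso {V W : Type*} {G : SimpleGraph V} {H : SimpleGraph W} (e : G ≃g H)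
    {u c m p : W} (h : IsBroomOff H u c m p) :
    IsBroomOff G (e.symm u) (e.symm c) (e.symm m) (e.symm p) := by
  obtain ⟨huc, hum, hup, hcm, hcp, hmp, adj⟩ := h
  refine ⟨by simpa, by simpa, by simpa, by simpa, by simpa, by simpa, fun x y hx hy => ?_⟩
  have key : ∀ z w, z = e.symm w ↔ e z = w := fun z w => e.toEquiv.eq_symm_apply
  simp only [ne_eq, key] at *
  rw [← e.map_adj_iff]
  exact adj _ _ hx hy

theorem IsBroomOff.sombor_eq {V : Type*} [Fintype V] [DecidableEq V] {G : SimpleGraph V}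
    [DecidableRel G.Adj] {u c m p : V} {n k : ℕ} (h : IsBroomOff G u c m p) (hn : 23 ≤ n)
    (hk : 4 ≤ k) (hkn : k + 2 ≤ n) (hV : Fintype.card V = n) (hu : G.degree u = k)
    (hc : G.Adj u c) (hm : G.Adj u m) (hp : G.Adj u p) : sombor G = phiPrime n k := by
  rw [sombor_eq_add G u, phiPrime_eq, h.sum_apex_eq hV hu hc hm hp,
    (h.sum_rest_le hn hk hkn hV hu).2.mpr ⟨hc, hm, hp⟩]

end Families

/-! ### Case analysis on the largest excess -/

theorem theorem3p3 (n k : ℕ) (hn : 23 ≤ n) (hk : 4 ≤ k) (hkn : k + 2 ≤ n)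
    {V : Type*} [Fintype V] [DecidableEq V] (G : SimpleGraph V) [DecidableRel G.Adj]
    (hG : IsQuasiTreeOf G n k)
    (hQ : ¬ Nonempty (G ≃g graphQ n k))
    (hQStar : ¬ Nonempty (G ≃g graphQStar n k)) :
    sombor G ≤ phiPrime n k ∧
      (sombor G = phiPrime n k ↔ Nonempty (G ≃g graphQPrime n k)) := by
  classical
  have hV := hG.1
  obtain ⟨u, s, hu, hd, hs, hE⟩ := hG.exists_excess (by omega)
  have h : HasExcess G u s n k := ⟨hV, hu, hd, hs, hE⟩
  have hQ' : Nonempty (G ≃g graphQPrime n k) → sombor G = phiPrime n k := by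
    rintro ⟨e⟩
    obtain ⟨a1, a2, a3⟩ := graphQPrime_adj (n := n) (k := k) (by omega) (by omega)
    refine (IsBroomOff.of_iso e (graphQPrime_isBroomOff (by omega))).sombor_eq hn hk hkn hV ?_
      (e.symm.map_adj_iff.mpr a1) (e.symm.map_adj_iff.mpr a2) (e.symm.map_adj_iff.mpr a3)
    rw [e.symm.degree_eq, graphQPrime_degree (by omega) (by omega)]
  have hcard : Fintype.card V = Fintype.card (Fin n) := by rw [hV, Fintype.card_fin]
  have hnotstar : ∀ c, c ≠ u → s c + 4 ≤ n := by
    intro c hc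
    by_contra hlt
    have h1 : s c ≤ ∑ x ∈ Finset.univ.erase u, s x :=
      Finset.single_le_sum (fun _ _ => Nat.zero_le _) (by simpa using hc)
    have hstar := h.isStarOff hc (by omega)
    -- A star off the apex gives `graphQ` or `graphQStar`, according to whether the apex is joined
    -- to the centre.
    by_cases huc : G.Adj u c
    · refine hQ (hstar.nonempty_iso (graphQ_isStarOff (by omega)) hcard ?_ ?_)
      · rw [hu, graphQ_degree (by omega) (by omega) (by omega)]
      · simp only [huc, true_iff]
        simp [graphQ]
    · refine hQStar (hstar.nonempty_iso (graphQStar_isStarOff (by omega)) hcard ?_ ?_)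
      · rw [hu, graphQStar_degree (by omega) (by omega)]
      · simp only [huc, false_iff]
        simp [graphQStar]
  have hapex := h.sum_apex_le (by omega) (by omega) hnotstar
  by_cases hbroom : ∃ c, c ≠ u ∧ s c + 4 = n
  · obtain ⟨c, hc, hsc⟩ := hbroom
    obtain ⟨m, p, hb⟩ := h.exists_isBroomOff hc hsc
    obtain ⟨hle, heq⟩ := hb.sum_rest_le hn hk hkn hV hu
    rw [sombor_eq_add G u, phiPrime_eq] at *
    refine ⟨by linarith, fun e => ?_, hQ'⟩
    -- Equality in the total forces equality in both partial bounds, and the one for the tree edges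
    -- yields the three adjacencies.
    obtain ⟨uc, um, up⟩ := heq.mp (by linarith)
    obtain ⟨a1, a2, a3⟩ := graphQPrime_adj (n := n) (k := k) (by omega) (by omega)
    refine hb.nonempty_iso (graphQPrime_isBroomOff (by omega)) hcard ?_ uc um up a1 a2 a3
    rw [hu, graphQPrime_degree (by omega) (by omega)]
  · have hrest : ∑ e ∈ G.edgeFinset.filter (fun e => u ∉ e), edgeWeight G e ≤
        ((n : ℝ) - 2) * (n - 3) := by
      by_cases hmid : ∃ c, c ≠ u ∧ s c + 5 = n
      · obtain ⟨c, hc, hsc⟩ := hmid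
        exact h.sum_rest_le_of_excess_eq hn hc hsc
      · push Not at hbroom hmid
        refine h.sum_rest_le_of_small (by omega) fun x hx => ?_
        have := hnotstar x hx
        have := hbroom x hx
        have := hmid x hx
        omega
    have hlt := lt_restBound (n := n) (k := k) (by omega) (by omega)
    have hsom : sombor G < phiPrime n k := by
      rw [sombor_eq_add G u, phiPrime_eq]
      linarith
    exact ⟨hsom.le, fun e => absurd e hsom.ne, hQ'⟩
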